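/- For $\eta,\zeta\in[-1,1]$ ($\eta$ = sine of latitude, $\zeta$ = cosine of obliquity) let \[ s(\eta,\zeta)=\frac{2}{\pi^2}\int_0^{2\pi}\sqrt{1-\left(\sqrt{1-\eta^2}\sqrt{1-\zeta^2}\,\sin\gamma-\eta\zeta\right)^2}\,d\gamma \] be the annual average insolation distribution function, and let $P_m$ denote the Legendre polynomial of degree $m$ (normalized by $P_m(1)=1$). Then $s\in L^2([-1,1]\times[-1,1])$ and \[ s(\eta,\zeta)=\sum_{n=0}^\infty A_{2n}P_{2n}(\zeta)P_{2n}(\eta), \] where the series converges to $s$ in $L^2([-1,1]\times[-1,1])$ and \[ A_{2n}=\frac{(-1)^n(4n+1)}{2^{2n-1}}\sum_{k=0}^n\binom{2n}{n-k}\binom{2n+2k}{2k}\binom{1/2}{k+1},\qquad \binom{r}{j}=\frac{r(r-1)\cdots(r-j+1)}{j!}. \] In particular, if $c_{ij}$ denotes the coefficient of $P_i(\zeta)P_j(\eta)$ in the expansion of $s$ with respect to the complete orthogonal system $\{P_i(\zeta)P_j(\eta)\}_{i,j\ge 0}$ of $L^2([-1,1]\times[-1,1])$, that is, \[ c_{ij}=\frac{\int_{-1}^1\int_{-1}^1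 s(\eta,\zeta)P_i(\zeta)P_j(\eta)\,d\eta\,d\zeta}{\int_{-1}^1\int_{-1}^1 P_i(\zeta)^2P_j(\eta)^2\,d\eta\,d\zeta}, \] then $c_{2n,2n}=A_{2n}$ for all $n\ge 0$, and $c_{ij}=0$ whenever $i\ne j$ or one of $i,j$ is odd. -/

import Mathlib

open MeasureTheory Set Filter Topology

noncomputable section

/-- The annual average insolation distribution of a rapidly rotating planet, as a function of the
latitude `α ∈ [-π/2, π/2]` and the obliquity `β ∈ [0, π]`. -/
def insolationAngle (α β : ℝ) : ℝ :=
  2 / Real.pi ^ 2 * ∫ γ in (0 : ℝ)..(2 * Real.pi),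
    √(1 - (Real.cos α * Real.sin β * Real.sin γ - Real.sin α * Real.cos β) ^ 2)

/-- The annual average insolation distribution, as a function of the sine `η ∈ [-1, 1]` of the
latitude and the cosine `ζ ∈ [-1, 1]` of the obliquity. -/
def insolation (η ζ : ℝ) : ℝ :=
  2 / Real.pi ^ 2 * ∫ γ in (0 : ℝ)..(2 * Real.pi),
    √(1 - (√(1 - η ^ 2) * √(1 - ζ ^ 2) * Real.sin γ - η * ζ) ^ 2)

theorem insolation_sin_cos {α β : ℝ} (hα : α ∈ Icc (-(Real.pi / 2)) (Real.pi / 2))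
    (hβ : β ∈ Icc 0 Real.pi) :
    insolation (Real.sin α) (Real.cos β) = insolationAngle α β := by
  have h1 := Real.cos_eq_sqrt_one_sub_sin_sq hα.1 hα.2
  have h2 := Real.sin_eq_sqrt_one_sub_cos_sq hβ.1 hβ.2
  simp only [insolation, insolationAngle, ← h1, ← h2]

/-- The Legendre polynomial `P_n`, by Rodrigues' formula
`P_n(x) = 1 / (2 ^ n * n!) * (d/dx)^n (x ^ 2 - 1) ^ n`. -/
def legendreP (n : ℕ) : Polynomial ℝ :=
  Polynomial.C (1 / (2 ^ n * (n.factorial : ℝ))) *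
    Polynomial.derivative^[n] ((Polynomial.X ^ 2 - 1) ^ n)

/-- Lebesgue measure on the square `[-1, 1] × [-1, 1]`; its points are written `(η, ζ)`. -/
def squareMeasure : Measure (ℝ × ℝ) :=
  volume.restrict (Icc (-1 : ℝ) 1 ×ˢ Icc (-1 : ℝ) 1)

/-- The product `(η, ζ) ↦ P_i(ζ) P_j(η)`. -/
def legendreProd (i j : ℕ) (p : ℝ × ℝ) : ℝ :=
  (legendreP i).eval p.2 * (legendreP j).eval p.1

/-- The coefficient `⟨f, P_i P_j⟩ / ‖P_i P_j‖²` of `P_i(ζ) P_j(η)` in the expansion of `f` with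
respect to the orthogonal system of these products in `L²([-1, 1] × [-1, 1])`. -/
def legendreCoeff (f : ℝ × ℝ → ℝ) (i j : ℕ) : ℝ :=
  (∫ p, f p * legendreProd i j p ∂squareMeasure) /
    ∫ p, legendreProd i j p ^ 2 ∂squareMeasure

/-- The number `A_{2n}`; `Ring.choose r j` is `r (r - 1) ⋯ (r - j + 1) / j!`. -/
def insolationCoeff (n : ℕ) : ℝ :=
  (-1) ^ n * (4 * (n : ℝ) + 1) / (2 : ℝ) ^ (2 * (n : ℤ) - 1) *
    ∑ k ∈ Finset.range (n + 1),
      ((2 * n).choose (n - k) : ℝ) * ((2 * n + 2 * k).choose (2 * k) : ℝ) *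
        Ring.choose (1 / 2 : ℝ) (k + 1)

end

/-! Up to the factor `4 / π`, `insolation η ζ` is the mean over `γ` of `f(x) = √(1 - x²)` at `x = ηζ
- √(1 - η²) √(1 - ζ²) sin γ`. This is an average over a circle on the sphere, so it should be
diagonal in Legendre polynomials (Funk–Hecke). Algebraically: the mean of a polynomial is a
polynomial in `η` (`integral_eval_zonal`), and averaging commutes with the Legendre operator
(`legendreOp_zonalPoly`). Its eigenspaces on polynomials are lines (`exists_smul_legendreP`), so
`P_n` averages to a multiple of `P_n(η)`, and `η = 1` identifies the multiple as `P_n(ζ)`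
(`eval_zonalPoly_legendreP`).

By Weierstrass, `f` is a uniform limit of polynomials, hence `insolation` is a uniform limit of
combinations of the products `P_n(ζ) P_n(η)` (`exists_sum_legendreP_near_insolation`). Orthogonality
removes the off-diagonal coefficients and reduces the diagonal ones to `∫ f P_n`
(`integral_insolation_mul_legendreProd`), which vanishes for odd `n` by parity and is a sum of
moments of `f` for even `n`. Since Legendre partial sums are best mean-square approximations, the
uniform approximation also gives `L²` convergence. -/

/-! ### Legendre polynomials and their differential equation -/

theorem coeff_X_sq_sub_one_pow_even (n i : ℕ) :
    ((Polynomial.X ^ 2 - 1 : Polynomial ℝ) ^ n).coeff (2 * i) =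
      (-1) ^ (n - i) * (n.choose i : ℝ) := by
  have h : ((Polynomial.X ^ 2 - 1 : Polynomial ℝ) ^ n) =
      Polynomial.expand ℝ 2 ((Polynomial.X + Polynomial.C (-1)) ^ n) := by
    simp [sub_eq_add_neg]
  rw [h, mul_comm 2 i, Polynomial.coeff_expand_mul (by norm_num), Polynomial.coeff_X_add_C_pow]

theorem coeff_X_sq_sub_one_pow_odd (n i : ℕ) (hi : Odd i) :
    ((Polynomial.X ^ 2 - 1 : Polynomial ℝ) ^ n).coeff i = 0 := by
  have h : ((Polynomial.X ^ 2 - 1 : Polynomial ℝ) ^ n) =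
      Polynomial.expand ℝ 2 ((Polynomial.X + Polynomial.C (-1)) ^ n) := by
    simp [sub_eq_add_neg]
  rw [h, Polynomial.coeff_expand (by norm_num), if_neg]
  rw [← even_iff_two_dvd]
  exact Nat.not_even_iff_odd.2 hi

/-- With `u = (X² - 1)^n`, compare coefficients of `X^(j+1)` in `(X² - 1) u' = 2 n X u`. -/
theorem coeff_X_sq_sub_one_pow_add_two (n j : ℕ) :
    ((j : ℝ) + 2) * ((Polynomial.X ^ 2 - 1 : Polynomial ℝ) ^ n).coeff (j + 2) =
      ((j : ℝ) - 2 * n) * ((Polynomial.X ^ 2 - 1 : Polynomial ℝ) ^ n).coeff j := by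
  set u : Polynomial ℝ := (Polynomial.X ^ 2 - 1 : Polynomial ℝ) ^ n with hu
  have h : Polynomial.X * (Polynomial.X * Polynomial.derivative u) - Polynomial.derivative u =
      Polynomial.X * (Polynomial.C (2 * (n : ℝ)) * u) := by
    rcases n with _ | n
    · simp [hu]
    · simp only [hu, Polynomial.derivative_pow, Polynomial.derivative_sub,
        Polynomial.derivative_one]
      simp
      ring
  have hc : ∀ j, (Polynomial.X * Polynomial.derivative u).coeff j = j * u.coeff j := by
    intro j
    rcases j with _ | j
    · simp
    · rw [Polynomial.coeff_X_mul, Polynomial.coeff_derivative]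
      push_cast
      ring
  have h2 := congrArg (fun p => Polynomial.coeff p (j + 1)) h
  simp only [Polynomial.coeff_sub, Polynomial.coeff_X_mul, hc, Polynomial.coeff_derivative,
    Polynomial.coeff_C_mul] at h2
  push_cast at h2
  have : j + 1 + 1 = j + 2 := rfl
  rw [this] at h2
  linarith

theorem coeff_legendreP (n k : ℕ) :
    (legendreP n).coeff k = 1 / (2 ^ n * (n.factorial : ℝ)) * ((k + n).descFactorial n *
      ((Polynomial.X ^ 2 - 1 : Polynomial ℝ) ^ n).coeff (k + n)) := by
  rw [legendreP, Polynomial.coeff_C_mul, Polynomial.coeff_iterate_derivative, nsmul_eq_mul]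

/-- This is Legendre's equation read off coefficientwise. It follows from the recursion for `(X² -
1)^n` at index `k + n`, because `(k + n + 1) (k - n) = k (k + 1) - n (n + 1)`. -/
theorem coeff_legendreP_add_two (n k : ℕ) :
    ((k : ℝ) + 2) * (k + 1) * (legendreP n).coeff (k + 2) =
      (k * (k + 1) - n * (n + 1)) * (legendreP n).coeff k := by
  have h := coeff_X_sq_sub_one_pow_add_two n (k + n)
  have h1 : (k + 2 + n) = k + n + 2 := by ring
  rw [coeff_legendreP, coeff_legendreP, h1]
  have e1 : ((k + n).descFactorial n : ℝ) * k.factorial = (k + n).factorial := by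
    have := Nat.factorial_mul_descFactorial (Nat.le_add_left n k)
    rw [Nat.add_sub_cancel] at this
    rw [mul_comm]
    exact_mod_cast this
  have e2 : ((k + n + 2).descFactorial n : ℝ) * ((k + 2) * (k + 1) * k.factorial) =
      (k + n + 2) * (k + n + 1) * (k + n).factorial := by
    have := Nat.factorial_mul_descFactorial (show n ≤ k + n + 2 by omega)
    rw [show k + n + 2 - n = k + 2 by omega] at this
    simp only [Nat.factorial_succ] at this
    have h3 : ((((k + 1 + 1) * ((k + 1) * k.factorial) * (k + n + 2).descFactorial n : ℕ)) : ℝ) =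
      (((k + n + 1 + 1) * ((k + n + 1) * (k + n).factorial) : ℕ) : ℝ) := by exact_mod_cast this
    push_cast at h3
    linarith
  have hk : (k.factorial : ℝ) ≠ 0 := by positivity
  have e3 : ((k + n + 2).descFactorial n : ℝ) * ((k + 2) * (k + 1)) =
      (k + n + 2) * (k + n + 1) * (k + n).descFactorial n := by
    apply mul_right_cancel₀ hk
    linear_combination e2 - (k + n + 2) * (k + n + 1) * e1
  push_cast at h
  linear_combination (1 / (2 ^ n * (n.factorial : ℝ))) *
    (((Polynomial.X ^ 2 - 1 : Polynomial ℝ) ^ n).coeff (k + n + 2) * e3 +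
      (k + n + 1) * (k + n).descFactorial n * h)

/-- The Legendre differential operator `p ↦ ((1 - x²) p')'` on polynomials. -/
noncomputable def legendreOp : Polynomial ℝ →ₗ[ℝ] Polynomial ℝ :=
  Polynomial.derivative ∘ₗ
    (LinearMap.mulLeft ℝ (1 - Polynomial.X ^ 2 : Polynomial ℝ)) ∘ₗ Polynomial.derivative

theorem legendreOp_apply (p : Polynomial ℝ) :
    legendreOp p = Polynomial.derivative ((1 - Polynomial.X ^ 2) * Polynomial.derivative p) := rfl

theorem coeff_legendreOp (p : Polynomial ℝ) (k : ℕ) :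
    (legendreOp p).coeff k = (k + 2) * (k + 1) * p.coeff (k + 2) - k * (k + 1) * p.coeff k := by
  have h : (1 - Polynomial.X ^ 2) * Polynomial.derivative p =
      Polynomial.derivative p - Polynomial.X * (Polynomial.X * Polynomial.derivative p) := by ring
  rw [legendreOp_apply, h, Polynomial.coeff_derivative, Polynomial.coeff_sub,
    Polynomial.coeff_X_mul, Polynomial.coeff_derivative]
  rcases k with _ | k
  · simp; ring
  · rw [Polynomial.coeff_X_mul, Polynomial.coeff_derivative]
    push_cast
    ring_nf

theorem legendreOp_legendreP (n : ℕ) :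
    legendreOp (legendreP n) = (-(n * (n + 1)) : ℝ) • legendreP n := by
  ext k
  rw [coeff_legendreOp, coeff_legendreP_add_two, Polynomial.coeff_smul, smul_eq_mul]
  ring

theorem coeff_legendreP_self_ne_zero (n : ℕ) : (legendreP n).coeff n ≠ 0 := by
  rw [coeff_legendreP, ← two_mul, coeff_X_sq_sub_one_pow_even]
  have : 0 < (2 * n).descFactorial n := Nat.descFactorial_pos.2 (by omega)
  simp [Nat.factorial_ne_zero, this.ne']

/-- An eigenpolynomial of the Legendre operator is determined by one coefficient. -/
theorem eq_zero_of_legendreOp_eq {n : ℕ} {q : Polynomial ℝ}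
    (hq : legendreOp q = (-(n * (n + 1)) : ℝ) • q) (h0 : q.coeff n = 0) : q = 0 := by
  by_contra hne
  have h := congrArg (fun p => Polynomial.coeff p q.natDegree) hq
  simp only [coeff_legendreOp, Polynomial.coeff_smul, smul_eq_mul] at h
  rw [Polynomial.coeff_eq_zero_of_natDegree_lt (show q.natDegree < q.natDegree + 2 by omega)] at h
  have hl : q.coeff q.natDegree ≠ 0 := by simpa using hne
  -- The leading coefficient, in degree `d`, forces `d (d + 1) = n (n + 1)`.
  have h2 : ((q.natDegree : ℝ) - n) * (q.natDegree + n + 1) = 0 := by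
    apply mul_right_cancel₀ hl
    linarith
  rcases mul_eq_zero.1 h2 with h3 | h3
  · have : q.natDegree = n := by
      have : (q.natDegree : ℝ) = n := by linarith
      exact_mod_cast this
    rw [this] at hl
    exact hl h0
  · have : (0 : ℝ) < q.natDegree + n + 1 := by positivity
    linarith

theorem exists_smul_legendreP {n : ℕ} {q : Polynomial ℝ}
    (hq : legendreOp q = (-(n * (n + 1)) : ℝ) • q) : ∃ c : ℝ, q = c • legendreP n := by
  refine ⟨q.coeff n / (legendreP n).coeff n, ?_⟩
  rw [← sub_eq_zero]
  apply eq_zero_of_legendreOp_eq (n := n)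
  · rw [map_sub, map_smul, hq, legendreOp_legendreP, smul_sub, smul_comm]
  · have := coeff_legendreP_self_ne_zero n
    simp [this]

theorem natDegree_legendreP (n : ℕ) : (legendreP n).natDegree = n := by
  apply le_antisymm
  · rw [Polynomial.natDegree_le_iff_coeff_eq_zero]
    intro k hk
    rw [coeff_legendreP, Polynomial.coeff_eq_zero_of_natDegree_lt]
    · simp
    · have h : ((Polynomial.X ^ 2 - 1 : Polynomial ℝ) ^ n).natDegree ≤ n * 2 := by
        apply Polynomial.natDegree_pow_le_of_le
        compute_degree
      omega
  · exact Polynomial.le_natDegree_of_ne_zero (coeff_legendreP_self_ne_zero n)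

theorem eval_one_legendreP (n : ℕ) : (legendreP n).eval 1 = 1 := by
  -- Since `(X² - 1)^n = (X - 1)^n (X + 1)^n`, the `n`-th derivative at `1` is `n! * 2^n`.
  have h := Polynomial.aeval_iterate_derivative_self (A := ℝ)
    ((Polynomial.X ^ 2 - 1 : Polynomial ℝ) ^ n) n 1
    (p' := (Polynomial.X + 1) ^ n) (by
      rw [← mul_pow]
      simp
      ring)
  rw [legendreP, Polynomial.eval_C_mul]
  rw [Polynomial.coe_aeval_eq_eval] at h
  rw [h]
  simp
  rw [one_add_one_eq_two]
  field_simp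

theorem coeff_legendreP_eq_zero {n k : ℕ} (h : Odd (k + n)) : (legendreP n).coeff k = 0 := by
  rw [coeff_legendreP, coeff_X_sq_sub_one_pow_odd _ _ h]
  simp

theorem eval_neg_legendreP (n : ℕ) (x : ℝ) :
    (legendreP n).eval (-x) = (-1) ^ n * (legendreP n).eval x := by
  rw [Polynomial.eval_eq_sum_range, Polynomial.eval_eq_sum_range, Finset.mul_sum]
  refine Finset.sum_congr rfl fun k _ => ?_
  rcases Nat.even_or_odd (k + n) with h | h
  · rw [neg_pow]
    have : (-1 : ℝ) ^ k = (-1) ^ n := by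
      rw [← mul_right_inj' (pow_ne_zero n (show (-1 : ℝ) ≠ 0 by norm_num)), ← pow_add, ← pow_add]
      rw [add_comm n k, h.neg_one_pow, ← two_mul, pow_mul]
      simp
    rw [this]
    ring
  · rw [coeff_legendreP_eq_zero h]
    simp

theorem exists_sum_legendreP (N : ℕ) (p : Polynomial ℝ) (hp : p.degree < N) :
    ∃ b : ℕ → ℝ, p = ∑ n ∈ Finset.range N, b n • legendreP n := by
  induction N generalizing p with
  | zero => exact ⟨0, by simpa using hp⟩
  | succ N ih =>
    set c := p.coeff N / (legendreP N).coeff N with hc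
    obtain ⟨b, hb⟩ := ih (p - c • legendreP N) (by
      rw [Polynomial.degree_lt_iff_coeff_zero] at hp ⊢
      intro m hm
      rcases hm.eq_or_lt with rfl | hm
      · have := coeff_legendreP_self_ne_zero N
        simp [hc, this]
      · rw [Polynomial.coeff_sub, hp m (by omega), Polynomial.coeff_smul,
          Polynomial.coeff_eq_zero_of_natDegree_lt (by rwa [natDegree_legendreP])]
        simp)
    refine ⟨fun n => if n = N then c else b n, ?_⟩
    rw [Finset.sum_range_succ]
    simp only [↓reduceIte]
    rw [← sub_eq_iff_eq_add, hb]
    refine Finset.sum_congr rfl fun n hn => ?_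
    rw [if_neg (Finset.mem_range.1 hn).ne]

/-! ### Orthogonality and norms -/

/-- Integration of polynomials over `[-1, 1]`. -/
noncomputable def polyIntegral : Polynomial ℝ →ₗ[ℝ] ℝ where
  toFun p := ∫ x in (-1 : ℝ)..1, p.eval x
  map_add' p q := by
    simp only [Polynomial.eval_add]
    exact intervalIntegral.integral_add (p.continuous.intervalIntegrable _ _)
      (q.continuous.intervalIntegrable _ _)
  map_smul' c p := by
    simp only [Polynomial.eval_smul, smul_eq_mul, RingHom.id_apply]
    exact intervalIntegral.integral_const_mul _ _

theorem polyIntegral_apply (p : Polynomial ℝ) :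
    polyIntegral p = ∫ x in (-1 : ℝ)..1, p.eval x := rfl

theorem polyIntegral_derivative (p : Polynomial ℝ) :
    polyIntegral (Polynomial.derivative p) = p.eval 1 - p.eval (-1) :=
  intervalIntegral.integral_eq_sub_of_hasDerivAt (fun x _ => p.hasDerivAt x)
    ((Polynomial.derivative p).continuous.intervalIntegrable _ _)

/-- The difference of the integrands is the derivative of `(1 - x²) (p' q - p q')`, which vanishes
at `±1`. -/
theorem polyIntegral_legendreOp_mul (p q : Polynomial ℝ) :
    polyIntegral (legendreOp p * q) = polyIntegral (p * legendreOp q) := by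
  have h := polyIntegral_derivative ((1 - Polynomial.X ^ 2) * Polynomial.derivative p * q -
    p * ((1 - Polynomial.X ^ 2) * Polynomial.derivative q))
  rw [← sub_eq_zero, ← map_sub]
  have e : legendreOp p * q - p * legendreOp q =
      Polynomial.derivative ((1 - Polynomial.X ^ 2) * Polynomial.derivative p * q -
        p * ((1 - Polynomial.X ^ 2) * Polynomial.derivative q)) := by
    rw [Polynomial.derivative_sub, Polynomial.derivative_mul (g := q),
      Polynomial.derivative_mul (f := p), legendreOp_apply, legendreOp_apply]
    ring
  rw [e, h]
  simp

theorem polyIntegral_legendreP_mul_of_ne {i j : ℕ} (hij : i ≠ j) :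
    polyIntegral (legendreP i * legendreP j) = 0 := by
  have h := polyIntegral_legendreOp_mul (legendreP i) (legendreP j)
  rw [legendreOp_legendreP, legendreOp_legendreP, smul_mul_assoc, mul_smul_comm, map_smul,
    map_smul, smul_eq_mul, smul_eq_mul] at h
  have h2 : ((i : ℝ) - j) * ((i + j + 1) * polyIntegral (legendreP i * legendreP j)) = 0 := by
    linear_combination -h
  have h3 : ((i : ℝ) - j) ≠ 0 := sub_ne_zero.2 (by exact_mod_cast hij)
  have h4 : ((i : ℝ) + j + 1) ≠ 0 := by positivity
  simpa [h3, h4] using h2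

theorem polyIntegral_legendreP_mul_of_degree_lt {n : ℕ} {p : Polynomial ℝ} (hp : p.degree < n) :
    polyIntegral (legendreP n * p) = 0 := by
  obtain ⟨b, rfl⟩ := exists_sum_legendreP n p hp
  rw [Finset.mul_sum, map_sum]
  refine Finset.sum_eq_zero fun k hk => ?_
  rw [mul_smul_comm, map_smul, polyIntegral_legendreP_mul_of_ne (Finset.mem_range.1 hk).ne',
    smul_zero]

theorem polyIntegral_legendreP_mul_self (n : ℕ) :
    polyIntegral (legendreP n * legendreP n) = 2 / (2 * n + 1) := by
  have h := polyIntegral_derivative (Polynomial.X * (legendreP n * legendreP n))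
  -- In `X P_n' - n P_n` the leading terms cancel, so it has degree below `n` and is orthogonal to
  -- `P_n`. Only the boundary value `2` of `x P_n²` remains.
  have e : Polynomial.derivative (Polynomial.X * (legendreP n * legendreP n)) =
      (2 * n + 1 : ℝ) • (legendreP n * legendreP n) + (2 : ℝ) • (legendreP n *
        (Polynomial.X * Polynomial.derivative (legendreP n) - (n : ℝ) • legendreP n)) := by
    simp only [Polynomial.derivative_mul, Polynomial.derivative_X, Polynomial.smul_eq_C_mul,
      Polynomial.C_add, Polynomial.C_mul, Polynomial.C_1, Polynomial.C_ofNat]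
    ring
  have hd : (Polynomial.X * Polynomial.derivative (legendreP n) -
      (n : ℝ) • legendreP n).degree < (n : WithBot ℕ) := by
    rw [Polynomial.degree_lt_iff_coeff_zero]
    intro m hm
    rcases m with _ | m
    · obtain rfl : n = 0 := by omega
      simp
    · rw [Polynomial.coeff_sub, Polynomial.coeff_X_mul, Polynomial.coeff_derivative,
        Polynomial.coeff_smul, smul_eq_mul]
      rcases hm.eq_or_lt with h | h
      · rw [h]
        push_cast
        ring
      · rw [Polynomial.coeff_eq_zero_of_natDegree_lt (by rwa [natDegree_legendreP])]
        simp
  rw [e, map_add, map_smul, map_smul, polyIntegral_legendreP_mul_of_degree_lt hd] at h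
  simp only [Polynomial.eval_mul, Polynomial.eval_X, eval_one_legendreP, smul_eq_mul] at h
  rw [eval_neg_legendreP, eval_one_legendreP] at h
  have h1 : ((-1 : ℝ) ^ n * 1) * ((-1) ^ n * 1) = 1 := by
    rw [mul_one, ← mul_pow]; simp
  rw [h1] at h
  rw [eq_div_iff (by positivity)]
  linarith

/-! ### Circle averages of polynomials and the addition theorem -/

/-- The mean of `sin ^ (2 k)` over a period. -/
noncomputable def sinPowMean (k : ℕ) : ℝ := (k.centralBinom : ℝ) / 4 ^ k

theorem sinPowMean_succ (k : ℕ) : (2 * k + 2) * sinPowMean (k + 1) = (2 * k + 1) * sinPowMean k := by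
  have h : ((k : ℝ) + 1) * (k + 1).centralBinom = 2 * (2 * k + 1) * k.centralBinom := by
    exact_mod_cast Nat.succ_mul_centralBinom_succ k
  rw [sinPowMean, sinPowMean, pow_succ]
  field_simp
  linarith

theorem integral_sin_pow_period_add_two (n : ℕ) :
    ∫ x in (0 : ℝ)..(2 * Real.pi), Real.sin x ^ (n + 2) =
      (n + 1) / (n + 2) * ∫ x in (0 : ℝ)..(2 * Real.pi), Real.sin x ^ n := by
  rw [integral_sin_pow]
  simp

theorem integral_sin_pow_even_period (k : ℕ) :
    ∫ x in (0 : ℝ)..(2 * Real.pi), Real.sin x ^ (2 * k) = 2 * Real.pi * sinPowMean k := by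
  induction k with
  | zero => simp [sinPowMean]
  | succ k ih =>
    have h := sinPowMean_succ k
    have h1 : (2 * (k : ℝ) + 2) ≠ 0 := by positivity
    rw [show 2 * (k + 1) = 2 * k + 2 by ring, integral_sin_pow_period_add_two, ih]
    push_cast
    field_simp
    linear_combination (-1) * h

theorem integral_sin_pow_odd_period (k : ℕ) :
    ∫ x in (0 : ℝ)..(2 * Real.pi), Real.sin x ^ (2 * k + 1) = 0 := by
  induction k with
  | zero => simp
  | succ k ih =>
    rw [show 2 * (k + 1) + 1 = 2 * k + 1 + 2 by ring, integral_sin_pow_period_add_two, ih, mul_zero]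

theorem sum_range_two_mul_of_odd_eq_zero {M : Type*} [AddCommMonoid M] (f : ℕ → M)
    (hf : ∀ k, f (2 * k + 1) = 0) (N : ℕ) :
    ∑ k ∈ Finset.range (2 * N), f k = ∑ k ∈ Finset.range N, f (2 * k) := by
  induction N with
  | zero => simp
  | succ N ih =>
    rw [Finset.sum_range_succ, ← ih, show 2 * (N + 1) = 2 * N + 1 + 1 by ring,
      Finset.sum_range_succ, Finset.sum_range_succ, hf, add_zero]

/-- Odd powers of the sine average to zero, so only `y²` survives. For `y = √(1 - η²) √(1 - ζ²)` the
radicals therefore disappear. -/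
theorem integral_sub_mul_sin_pow (x y : ℝ) (m : ℕ) :
    ∫ γ in (0 : ℝ)..(2 * Real.pi), (x - y * Real.sin γ) ^ m =
      2 * Real.pi * ∑ k ∈ Finset.range (m + 1),
        m.choose (2 * k) * sinPowMean k * (y ^ 2) ^ k * x ^ (m - 2 * k) := by
  -- The range is padded with vanishing binomials to an even length, so that it splits by parity.
  have h1 : ∀ γ : ℝ, (x - y * Real.sin γ) ^ m = ∑ k ∈ Finset.range (2 * (m + 1)),
      ((-y) ^ k * x ^ (m - k) * m.choose k) * Real.sin γ ^ k := by
    intro γ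
    rw [sub_eq_neg_add, add_pow]
    rw [← Finset.sum_subset (Finset.range_mono (show m + 1 ≤ 2 * (m + 1) by omega))]
    · refine Finset.sum_congr rfl fun k _ => ?_
      rw [← neg_mul, mul_pow]
      ring
    · intro k _ hk
      rw [Nat.choose_eq_zero_of_lt (by simpa using hk)]
      simp
  simp_rw [h1]
  rw [intervalIntegral.integral_finsetSum (fun k _ => by
    apply Continuous.intervalIntegrable; fun_prop)]
  simp_rw [intervalIntegral.integral_const_mul]
  rw [sum_range_two_mul_of_odd_eq_zero _ (fun k => by rw [integral_sin_pow_odd_period, mul_zero]),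
    Finset.mul_sum]
  refine Finset.sum_congr rfl fun k _ => ?_
  rw [integral_sin_pow_even_period, pow_mul, neg_sq]
  ring

open Polynomial in
/-- The mean over `γ` of `(ζ X - √(1 - X²) √(1 - ζ²) sin γ) ^ m`, as a polynomial in `X`. -/
noncomputable def zonalMonomial (ζ : ℝ) (m : ℕ) : Polynomial ℝ :=
  ∑ k ∈ Finset.range (m + 1), (m.choose (2 * k) * sinPowMean k * (1 - ζ ^ 2) ^ k *
    ζ ^ (m - 2 * k) : ℝ) • ((1 - X ^ 2) ^ k * X ^ (m - 2 * k) : Polynomial ℝ)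

open Polynomial in
theorem legendreOp_one_sub_X_sq_pow_mul_X_pow (k j : ℕ) :
    legendreOp ((1 - X ^ 2) ^ k * X ^ j) =
      (-((j + 2 * k) * (j + 2 * k + 1)) : ℝ) • ((1 - X ^ 2) ^ k * X ^ j : ℝ[X]) +
      (4 * k ^ 2 : ℝ) • ((1 - X ^ 2) ^ (k - 1) * X ^ j : ℝ[X]) +
      (j * (j - 1) : ℝ) • ((1 - X ^ 2) ^ k * X ^ (j - 2) : ℝ[X]) := by
  have hs : ∀ r : ℝ, ∀ p : ℝ[X], r • p = C r * p := fun r p => smul_eq_C_mul r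
  have h2 : (C 2 : ℝ[X]) = 2 := map_ofNat C 2
  have h4 : (C 4 : ℝ[X]) = 4 := map_ofNat C 4
  -- The small cases are those where `k - 1` or `j - 2` truncates; the factors `4 k²` and `j (j -
  -- 1)` then vanish.
  rcases k with _ | _ | k <;> rcases j with _ | _ | j <;>
  · simp only [legendreOp_apply, derivative_mul, derivative_pow, derivative_sub, derivative_one,
      derivative_X, hs, derivative_add, derivative_C]
    simp [h2, h4]
    try ring

/-- This collects the coefficient of `(1 - X²)^k X^(n - 2k)` in the degree-lowering part of
`legendreOp (zonalMonomial ζ (n + 2))`: term `k + 1` contributes through `4 k²`, term `k` through `j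
(j - 1)`. Their weights `1 - ζ²` and `ζ²` add up to `1`. -/
theorem zonal_coeff_identity (ζ : ℝ) (n k : ℕ) :
    ((n + 2).choose (2 * (k + 1)) * sinPowMean (k + 1) * (1 - ζ ^ 2) ^ (k + 1) *
        ζ ^ (n + 2 - 2 * (k + 1)) : ℝ) * (4 * ((k + 1 : ℕ) : ℝ) ^ 2) +
      ((n + 2).choose (2 * k) * sinPowMean k * (1 - ζ ^ 2) ^ k * ζ ^ (n + 2 - 2 * k) : ℝ) *
        (((n + 2 - 2 * k : ℕ) : ℝ) * (((n + 2 - 2 * k : ℕ) : ℝ) - 1)) =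
    ((n + 2 : ℕ) * ((n + 2 : ℕ) - 1) : ℝ) *
      (n.choose (2 * k) * sinPowMean k * (1 - ζ ^ 2) ^ k * ζ ^ (n - 2 * k) : ℝ) := by
  rcases le_or_gt (2 * k) n with h | h
  · obtain ⟨i, rfl⟩ := Nat.exists_eq_add_of_le h
    rw [show 2 * k + i + 2 - 2 * (k + 1) = i by omega, show 2 * k + i + 2 - 2 * k = i + 2 by omega,
      show 2 * k + i - 2 * k = i by omega, show 2 * (k + 1) = 2 * k + 1 + 1 by ring]
    have e1 : ((2 * k + i + 2).choose (2 * k + 1 + 1) : ℝ) * (2 * k + 2) * (2 * k + 1) =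
        (2 * k + i + 2) * (2 * k + i + 1) * (2 * k + i).choose (2 * k) := by
      have h1 := Nat.add_one_mul_choose_eq (2 * k + i + 1) (2 * k + 1)
      have h2 := Nat.add_one_mul_choose_eq (2 * k + i) (2 * k)
      have h1' : ((2 * k + i + 1 : ℝ) + 1) * (2 * k + i + 1).choose (2 * k + 1) =
        (2 * k + i + 2).choose (2 * k + 1 + 1) * (2 * k + 1 + 1) := by exact_mod_cast h1
      have h2' : ((2 * k + i : ℝ) + 1) * (2 * k + i).choose (2 * k) =
        (2 * k + i + 1).choose (2 * k + 1) * (2 * k + 1) := by exact_mod_cast h2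
      linear_combination (-(2 * k + 1 : ℝ)) * h1' - (2 * k + i + 2 : ℝ) * h2'
    have e2 : ((2 * k + i + 2).choose (2 * k) : ℝ) * (i + 2) * (i + 1) =
        (2 * k + i + 2) * (2 * k + i + 1) * (2 * k + i).choose (2 * k) := by
      have h1 := Nat.choose_mul_succ_eq (2 * k + i + 1) (2 * k)
      have h2 := Nat.choose_mul_succ_eq (2 * k + i) (2 * k)
      rw [show 2 * k + i + 1 + 1 - 2 * k = i + 2 by omega] at h1
      rw [show 2 * k + i + 1 - 2 * k = i + 1 by omega] at h2
      have h1' : ((2 * k + i + 1).choose (2 * k) : ℝ) * (2 * k + i + 1 + 1) =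
        (2 * k + i + 2).choose (2 * k) * (i + 2) := by exact_mod_cast h1
      have h2' : ((2 * k + i).choose (2 * k) : ℝ) * (2 * k + i + 1) =
        (2 * k + i + 1).choose (2 * k) * (i + 1) := by exact_mod_cast h2
      linear_combination (-(i + 1 : ℝ)) * h1' - (2 * k + i + 2 : ℝ) * h2'
    have e3 := sinPowMean_succ k
    push_cast
    rw [pow_succ (1 - ζ ^ 2) k]
    linear_combination ((1 - ζ ^ 2) ^ k * ζ ^ i) * (((1 - ζ ^ 2) * sinPowMean k) * e1 +
      ζ ^ 2 * sinPowMean k * e2 +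
      (1 - ζ ^ 2) * (2 * k + i + 2).choose (2 * k + 1 + 1) * (2 * k + 2) * e3)
  · rw [Nat.choose_eq_zero_of_lt h, Nat.choose_eq_zero_of_lt (show n + 2 < 2 * (k + 1) by omega)]
    have h3 : n + 2 - 2 * k = 0 ∨ n + 2 - 2 * k = 1 := by omega
    rcases h3 with h3 | h3 <;> rw [h3] <;> simp

-- `legendreOp` acts on `zonalMonomial ζ m` with the same two coefficients as on `X ^ m`, which is
-- what makes averaging commute with it.
open Polynomial in
theorem legendreOp_zonalMonomial (ζ : ℝ) (m : ℕ) :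
    legendreOp (zonalMonomial ζ m) = (m * (m - 1) : ℝ) • zonalMonomial ζ (m - 2) -
      (m * (m + 1) : ℝ) • zonalMonomial ζ m := by
  have hA : ∀ k, (m.choose (2 * k) * sinPowMean k * (1 - ζ ^ 2) ^ k * ζ ^ (m - 2 * k) : ℝ) •
      (-(((m - 2 * k : ℕ) + 2 * k) * ((m - 2 * k : ℕ) + 2 * k + 1)) : ℝ) •
        ((1 - X ^ 2) ^ k * X ^ (m - 2 * k) : ℝ[X]) =
      (-(m * (m + 1)) : ℝ) • (m.choose (2 * k) * sinPowMean k * (1 - ζ ^ 2) ^ k *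
        ζ ^ (m - 2 * k) : ℝ) • ((1 - X ^ 2) ^ k * X ^ (m - 2 * k) : ℝ[X]) := by
    intro k
    rcases le_or_gt (2 * k) m with h | h
    · rw [smul_comm]
      congr 1
      push_cast [Nat.cast_sub h]
      ring
    · rw [Nat.choose_eq_zero_of_lt h]
      simp
  rcases m with _ | _ | n
  · simp [zonalMonomial, legendreOp_apply]
  · simp [zonalMonomial, legendreOp_apply, Finset.sum_range_succ, smul_eq_C_mul]
    ring
  · rw [zonalMonomial, map_sum]
    simp only [map_smul, legendreOp_one_sub_X_sq_pow_mul_X_pow, smul_add, hA,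
      Finset.sum_add_distrib]
    rw [← Finset.smul_sum, ← zonalMonomial, add_assoc, neg_smul, neg_add_eq_sub]
    congr 1
    -- The `4 k²` sum loses its zero term at `k = 0` and is shifted; the other sum loses its
    -- vanishing last term. The two then match index by index.
    rw [Finset.sum_range_succ', Finset.sum_range_succ (n := n + 1 + 1), zonalMonomial,
      Nat.choose_eq_zero_of_lt (show n + 1 + 1 < 2 * (n + 1 + 1) by omega),
      show n + 1 + 1 - 2 = n by omega]
    have hx : ∑ k ∈ Finset.range (n + 1), (n.choose (2 * k) * sinPowMean k * (1 - ζ ^ 2) ^ k *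
        ζ ^ (n - 2 * k) : ℝ) • ((1 - X ^ 2) ^ k * X ^ (n - 2 * k) : Polynomial ℝ) =
      ∑ k ∈ Finset.range (n + 2), (n.choose (2 * k) * sinPowMean k * (1 - ζ ^ 2) ^ k *
        ζ ^ (n - 2 * k) : ℝ) • ((1 - X ^ 2) ^ k * X ^ (n - 2 * k) : Polynomial ℝ) := by
      rw [Finset.sum_range_succ (n := n + 1),
        Nat.choose_eq_zero_of_lt (show n < 2 * (n + 1) by omega)]
      simp
    rw [hx, Finset.smul_sum]
    simp only [CharP.cast_eq_zero, zero_mul, zero_smul, add_zero, ne_eq,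
      OfNat.ofNat_ne_zero, not_false_eq_true, zero_pow, mul_zero, smul_zero]
    rw [← Finset.sum_add_distrib]
    refine Finset.sum_congr rfl fun k _ => ?_
    rw [show n + 1 + 1 - 2 * k - 2 = n - 2 * k by omega,
      show X ^ (n + 1 + 1 - 2 * (k + 1)) = (X ^ (n - 2 * k) : ℝ[X]) by congr 1; omega,
      Nat.add_sub_cancel, smul_smul, smul_smul, smul_smul, ← add_smul, zonal_coeff_identity]

/-- The linear operator sending `X ^ m` to `zonalMonomial ζ m`. -/
noncomputable def zonalPoly (ζ : ℝ) : Polynomial ℝ →ₗ[ℝ] Polynomial ℝ :=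
  Polynomial.lsum fun m => LinearMap.toSpanSingleton ℝ _ (zonalMonomial ζ m)

theorem zonalPoly_monomial (ζ : ℝ) (m : ℕ) (c : ℝ) :
    zonalPoly ζ (Polynomial.monomial m c) = c • zonalMonomial ζ m := by
  simp [zonalPoly, Polynomial.lsum_apply, Polynomial.sum_monomial_index]

open Polynomial in
theorem legendreOp_zonalPoly (ζ : ℝ) (p : Polynomial ℝ) :
    legendreOp (zonalPoly ζ p) = zonalPoly ζ (legendreOp p) := by
  induction p using Polynomial.induction_on' with
  | add p q hp hq => simp only [map_add, hp, hq]
  | monomial m c =>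
    have h := legendreOp_one_sub_X_sq_pow_mul_X_pow 0 m
    simp only [pow_zero, one_mul, Nat.cast_zero, mul_zero, add_zero, ne_eq, OfNat.ofNat_ne_zero,
      not_false_eq_true, zero_pow, zero_smul] at h
    rw [← mul_one c, ← smul_eq_mul, ← smul_monomial, map_smul, map_smul, map_smul, map_smul,
      monomial_one_right_eq_X_pow, h, ← monomial_one_right_eq_X_pow, ← monomial_one_right_eq_X_pow,
      map_add, map_smul, map_smul, zonalPoly_monomial, zonalPoly_monomial, one_smul, one_smul,
      legendreOp_zonalMonomial, neg_smul, sub_eq_neg_add]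

/-- The mean over `γ` of a polynomial at `ηζ - √(1 - η²) √(1 - ζ²) sin γ`. -/
theorem integral_eval_zonal (p : Polynomial ℝ) {η ζ : ℝ} (hη : η ∈ Icc (-1 : ℝ) 1)
    (hζ : ζ ∈ Icc (-1 : ℝ) 1) :
    ∫ γ in (0 : ℝ)..(2 * Real.pi),
        p.eval (η * ζ - √(1 - η ^ 2) * √(1 - ζ ^ 2) * Real.sin γ) =
      2 * Real.pi * (zonalPoly ζ p).eval η := by
  induction p using Polynomial.induction_on' with
  | add p q hp hq =>
    simp only [Polynomial.eval_add, map_add]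
    rw [intervalIntegral.integral_add, hp, hq]
    · ring
    all_goals
      apply Continuous.intervalIntegrable
      fun_prop
  | monomial m c =>
    have h1 : (0 : ℝ) ≤ 1 - η ^ 2 := by nlinarith [hη.1, hη.2]
    have h2 : (0 : ℝ) ≤ 1 - ζ ^ 2 := by nlinarith [hζ.1, hζ.2]
    simp only [Polynomial.eval_monomial]
    rw [intervalIntegral.integral_const_mul, integral_sub_mul_sin_pow, zonalPoly_monomial,
      Polynomial.eval_smul, zonalMonomial, Polynomial.eval_finsetSum, smul_eq_mul,
      mul_left_comm]
    congr 1
    congr 1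
    refine Finset.sum_congr rfl fun k _ => ?_
    rw [mul_pow √_, Real.sq_sqrt h1, Real.sq_sqrt h2, mul_pow, mul_pow]
    simp
    ring

/-- The averaged addition theorem for Legendre polynomials. -/
theorem eval_zonalPoly_legendreP (n : ℕ) (η : ℝ) {ζ : ℝ} (hζ : ζ ∈ Icc (-1 : ℝ) 1) :
    (zonalPoly ζ (legendreP n)).eval η = (legendreP n).eval ζ * (legendreP n).eval η := by
  obtain ⟨c, hc⟩ := exists_smul_legendreP (n := n) (q := zonalPoly ζ (legendreP n)) (by
    rw [legendreOp_zonalPoly, legendreOp_legendreP, map_smul])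
  -- At `η = 1` the circle degenerates to a point and the average is `P_n(ζ)`; as `P_n(1) = 1`, this
  -- is `c`.
  have h := integral_eval_zonal (legendreP n) (η := 1) (by simp) hζ
  simp only [one_pow, sub_self, Real.sqrt_zero, zero_mul, sub_zero, one_mul,
    intervalIntegral.integral_const, smul_eq_mul] at h
  have h3 : (legendreP n).eval ζ = (zonalPoly ζ (legendreP n)).eval 1 :=
    mul_left_cancel₀ (show 2 * Real.pi ≠ 0 by positivity) h
  rw [hc, Polynomial.eval_smul, eval_one_legendreP, smul_eq_mul, mul_one] at h3
  rw [hc, Polynomial.eval_smul, smul_eq_mul, h3]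

/-! ### Uniform approximation of the insolation -/

theorem insolation_eq (η ζ : ℝ) : insolation η ζ = 2 / Real.pi ^ 2 *
    ∫ γ in (0 : ℝ)..(2 * Real.pi),
      √(1 - (η * ζ - √(1 - η ^ 2) * √(1 - ζ ^ 2) * Real.sin γ) ^ 2) := by
  rw [insolation]
  congr 1
  refine intervalIntegral.integral_congr fun γ _ => ?_
  rw [← neg_sq, neg_sub]

theorem zonal_arg_mem_Icc {η ζ : ℝ} (hη : η ∈ Icc (-1 : ℝ) 1) (hζ : ζ ∈ Icc (-1 : ℝ) 1) (γ : ℝ) :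
    η * ζ - √(1 - η ^ 2) * √(1 - ζ ^ 2) * Real.sin γ ∈ Icc (-1 : ℝ) 1 := by
  have h1 : (0 : ℝ) ≤ 1 - η ^ 2 := by nlinarith [hη.1, hη.2]
  have h2 : (0 : ℝ) ≤ 1 - ζ ^ 2 := by nlinarith [hζ.1, hζ.2]
  have ha := Real.sq_sqrt h1
  have hb := Real.sq_sqrt h2
  set a := √(1 - η ^ 2)
  set b := √(1 - ζ ^ 2)
  have hs := Real.sin_sq_add_cos_sq γ
  rw [mem_Icc, ← abs_le, ← sq_le_one_iff_abs_le_one]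
  -- The three squared quantities are those of the coordinates of a unit vector.
  have : 1 - (η * ζ - a * b * Real.sin γ) ^ 2 =
      (η * b * Real.sin γ + a * ζ) ^ 2 + (b * Real.cos γ) ^ 2 := by
    linear_combination (-(b * Real.sin γ) ^ 2 - ζ ^ 2) * ha - hb - b ^ 2 * hs
  nlinarith [sq_nonneg (η * b * Real.sin γ + a * ζ), sq_nonneg (b * Real.cos γ)]

theorem continuous_insolation : Continuous fun p : ℝ × ℝ => insolation p.1 p.2 := by
  unfold insolation
  refine continuous_const.mul ?_
  apply intervalIntegral.continuous_parametric_intervalIntegral_of_continuous'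
  fun_prop

theorem abs_insolation_sub_zonalPoly_le {p : Polynomial ℝ} {ε : ℝ}
    (hp : ∀ x ∈ Icc (-1 : ℝ) 1, |p.eval x - √(1 - x ^ 2)| < ε)
    {η ζ : ℝ} (hη : η ∈ Icc (-1 : ℝ) 1) (hζ : ζ ∈ Icc (-1 : ℝ) 1) :
    |insolation η ζ - 4 / Real.pi * (zonalPoly ζ p).eval η| ≤ 4 / Real.pi * ε := by
  have hπ := Real.pi_pos
  have h1 : 4 / Real.pi * (zonalPoly ζ p).eval η = 2 / Real.pi ^ 2 *
      (2 * Real.pi * (zonalPoly ζ p).eval η) := by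
    field_simp
    ring
  rw [h1, ← integral_eval_zonal p hη hζ, insolation_eq, ← mul_sub,
    ← intervalIntegral.integral_sub, abs_mul, abs_of_pos (by positivity)]
  · have h := intervalIntegral.norm_integral_le_of_norm_le_const (a := 0) (b := 2 * Real.pi)
      (f := fun γ => √(1 - (η * ζ - √(1 - η ^ 2) * √(1 - ζ ^ 2) * Real.sin γ) ^ 2) -
        p.eval (η * ζ - √(1 - η ^ 2) * √(1 - ζ ^ 2) * Real.sin γ)) (C := ε) (fun γ _ => by
        rw [Real.norm_eq_abs, abs_sub_comm]
        exact (hp _ (zonal_arg_mem_Icc hη hζ γ)).le)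
    rw [sub_zero, abs_of_pos (by positivity), Real.norm_eq_abs] at h
    calc _ ≤ 2 / Real.pi ^ 2 * (ε * (2 * Real.pi)) := by gcongr
      _ = _ := by field_simp; ring
  all_goals
    apply Continuous.intervalIntegrable
    fun_prop

/-- One Weierstrass polynomial for `√(1 - x²)` serves both estimates, and sharing the coefficients
`b` is what ties the double integrals to one-variable ones. -/
theorem exists_sum_legendreP_near_insolation {ε : ℝ} (hε : 0 < ε) :
    ∃ (N : ℕ) (b : ℕ → ℝ),
      (∀ x ∈ Icc (-1 : ℝ) 1,
        |(∑ n ∈ Finset.range N, b n • legendreP n).eval x - √(1 - x ^ 2)| ≤ ε) ∧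
      ∀ z ∈ Icc (-1 : ℝ) 1 ×ˢ Icc (-1 : ℝ) 1,
        |insolation z.1 z.2 - 4 / Real.pi * ∑ n ∈ Finset.range N, b n * legendreProd n n z| ≤
          4 / Real.pi * ε := by
  obtain ⟨p, hp⟩ := exists_polynomial_near_of_continuousOn (-1) 1 (fun x => √(1 - x ^ 2))
    (by fun_prop) ε hε
  obtain ⟨b, hb⟩ := exists_sum_legendreP (p.natDegree + 1) p (by
    refine p.degree_le_natDegree.trans_lt ?_
    exact_mod_cast Nat.lt_succ_self _)
  refine ⟨p.natDegree + 1, b, fun x hx => ?_, fun z hz => ?_⟩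
  · rw [← hb]
    exact (hp x hx).le
  · have h := abs_insolation_sub_zonalPoly_le hp hz.1 hz.2
    have e : (zonalPoly z.2 p).eval z.1 =
        ∑ n ∈ Finset.range (p.natDegree + 1), b n * legendreProd n n z := by
      conv_lhs => rw [hb]
      simp only [map_sum, map_smul, Polynomial.eval_finsetSum, Polynomial.eval_smul, smul_eq_mul,
        eval_zonalPoly_legendreP _ _ hz.2, legendreProd]
    rwa [e] at h

/-! ### Integration over the square and reduction to one variable -/

theorem squareMeasure_eq_prod : squareMeasure =
    (volume.restrict (Icc (-1 : ℝ) 1)).prod (volume.restrict (Icc (-1 : ℝ) 1)) := by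
  rw [squareMeasure, Measure.prod_restrict, Measure.volume_eq_prod]

instance : IsFiniteMeasure squareMeasure := by
  rw [squareMeasure_eq_prod]
  infer_instance

theorem squareMeasure_real_univ : squareMeasure.real univ = 4 := by
  rw [squareMeasure_eq_prod, ← univ_prod_univ, measureReal_prod_prod]
  simp
  norm_num

theorem integrable_squareMeasure {F : ℝ × ℝ → ℝ} (hF : Continuous F) :
    Integrable F squareMeasure :=
  (hF.continuousOn.integrableOn_compact (isCompact_Icc.prod isCompact_Icc))

theorem ae_squareMeasure_mem : ∀ᵐ z ∂squareMeasure, z ∈ Icc (-1 : ℝ) 1 ×ˢ Icc (-1 : ℝ) 1 :=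
  ae_restrict_mem (measurableSet_Icc.prod measurableSet_Icc)

theorem continuous_legendreProd (i j : ℕ) : Continuous (legendreProd i j) := by
  unfold legendreProd
  fun_prop

theorem integral_Icc_eval (p : Polynomial ℝ) :
    ∫ x in Icc (-1 : ℝ) 1, p.eval x = polyIntegral p := by
  rw [polyIntegral_apply, intervalIntegral.integral_of_le (by norm_num), integral_Icc_eq_integral_Ioc]

theorem integral_legendreProd_mul (i j k l : ℕ) :
    ∫ z, legendreProd i j z * legendreProd k l z ∂squareMeasure =
      polyIntegral (legendreP i * legendreP k) * polyIntegral (legendreP j * legendreP l) := by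
  rw [← integral_Icc_eval, ← integral_Icc_eval, squareMeasure_eq_prod, mul_comm,
    ← integral_prod_mul]
  refine integral_congr_ae (.of_forall fun z => ?_)
  simp only [legendreProd, Polynomial.eval_mul]
  ring

theorem integral_sum_legendreProd_mul (N : ℕ) (b : ℕ → ℝ) (i j : ℕ) :
    ∫ z, (∑ n ∈ Finset.range N, b n * legendreProd n n z) * legendreProd i j z ∂squareMeasure =
      if i = j then polyIntegral (legendreP i * legendreP i) *
        polyIntegral ((∑ n ∈ Finset.range N, b n • legendreP n) * legendreP i) else 0 := by
  simp_rw [Finset.sum_mul, mul_assoc]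
  have hi : ∀ n, Integrable (fun z => b n * (legendreProd n n z * legendreProd i j z))
      squareMeasure := fun n => integrable_squareMeasure (continuous_const.mul
    ((continuous_legendreProd n n).mul (continuous_legendreProd i j)))
  rw [integral_finsetSum _ (fun n _ => hi n)]
  simp_rw [integral_const_mul, integral_legendreProd_mul, map_sum, smul_mul_assoc, map_smul,
    smul_eq_mul]
  split_ifs with h
  · subst h
    rw [Finset.mul_sum]
    refine Finset.sum_congr rfl fun n _ => ?_
    rcases eq_or_ne n i with rfl | hn
    · ring
    · rw [polyIntegral_legendreP_mul_of_ne hn]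
      ring
  · refine Finset.sum_eq_zero fun n _ => ?_
    rcases eq_or_ne n i with rfl | hn
    · rw [polyIntegral_legendreP_mul_of_ne h]
      ring
    · rw [polyIntegral_legendreP_mul_of_ne hn]
      ring

/-- The identity is exact when `√(1 - x²)` is replaced by a polynomial and `insolation` by the
corresponding average (`integral_sum_legendreProd_mul`). Both sides move by at most a constant times
`ε` under uniform approximation. -/
theorem integral_insolation_mul_legendreProd (i j : ℕ) :
    ∫ z, insolation z.1 z.2 * legendreProd i j z ∂squareMeasure =
      4 / Real.pi * if i = j then polyIntegral (legendreP i * legendreP i) *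
        ∫ x in (-1 : ℝ)..1, √(1 - x ^ 2) * (legendreP i).eval x else 0 := by
  obtain ⟨B, hB⟩ := (isCompact_Icc.prod isCompact_Icc : IsCompact
    (Icc (-1 : ℝ) 1 ×ˢ Icc (-1 : ℝ) 1)).exists_bound_of_continuousOn
      (continuous_legendreProd i j).continuousOn
  obtain ⟨B', hB'⟩ := (isCompact_Icc : IsCompact (Icc (-1 : ℝ) 1)).exists_bound_of_continuousOn
      (legendreP i).continuous.continuousOn
  set h := polyIntegral (legendreP i * legendreP i) with hh
  have hB0 : 0 ≤ B := (norm_nonneg _).trans (hB (0, 0) (by simp))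
  have hB0' : 0 ≤ B' := (norm_nonneg _).trans (hB' 0 (by simp))
  have key : ∀ ε : ℝ, 0 < ε → |(∫ z, insolation z.1 z.2 * legendreProd i j z ∂squareMeasure) -
      4 / Real.pi * if i = j then h *
        ∫ x in (-1 : ℝ)..1, √(1 - x ^ 2) * (legendreP i).eval x else 0| ≤
      ε * (4 / Real.pi * B * 4 + 4 / Real.pi * (|h| * (B' * 2))) := by
    intro ε hε
    obtain ⟨N, b, h1, h2⟩ := exists_sum_legendreP_near_insolation hε
    have e := integral_sum_legendreProd_mul N b i j
    set q : ℝ × ℝ → ℝ := fun z => ∑ n ∈ Finset.range N, b n * legendreProd n n z with hq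
    set p := ∑ n ∈ Finset.range N, b n • legendreP n with hp
    have hqc : Continuous q := by
      have := fun n => continuous_legendreProd n n
      fun_prop
    have d1 : |(∫ z, insolation z.1 z.2 * legendreProd i j z ∂squareMeasure) -
        4 / Real.pi * ∫ z, q z * legendreProd i j z ∂squareMeasure| ≤
        ε * (4 / Real.pi * B * 4) := by
      have hi1 : Integrable (fun z => insolation z.1 z.2 * legendreProd i j z) squareMeasure :=
        integrable_squareMeasure (continuous_insolation.mul (continuous_legendreProd i j))
      have hi2 : Integrable (fun z => 4 / Real.pi * (q z * legendreProd i j z)) squareMeasure :=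
        integrable_squareMeasure (continuous_const.mul (hqc.mul (continuous_legendreProd i j)))
      rw [← integral_const_mul, ← integral_sub hi1 hi2]
      have := norm_integral_le_of_norm_le_const (μ := squareMeasure)
        (f := fun z => insolation z.1 z.2 * legendreProd i j z -
          4 / Real.pi * (q z * legendreProd i j z)) (C := 4 / Real.pi * ε * B) (by
          filter_upwards [ae_squareMeasure_mem] with z hz
          rw [← mul_assoc, ← sub_mul, norm_mul]
          exact mul_le_mul (h2 z hz) (hB z hz) (norm_nonneg _) (by positivity))
      rw [squareMeasure_real_univ, Real.norm_eq_abs] at this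
      linarith
    have d2 : |polyIntegral (p * legendreP i) -
        ∫ x in (-1 : ℝ)..1, √(1 - x ^ 2) * (legendreP i).eval x| ≤ ε * (B' * 2) := by
      rw [polyIntegral_apply, ← intervalIntegral.integral_sub]
      · have := intervalIntegral.norm_integral_le_of_norm_le_const (a := -1) (b := 1)
          (f := fun x => (p * legendreP i).eval x - √(1 - x ^ 2) * (legendreP i).eval x)
          (C := ε * B') (fun x hx => by
            rw [uIoc_of_le (by norm_num)] at hx
            rw [Polynomial.eval_mul, ← sub_mul, norm_mul]
            exact mul_le_mul (h1 x (Ioc_subset_Icc_self hx)) (hB' x (Ioc_subset_Icc_self hx))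
              (norm_nonneg _) hε.le)
        rw [Real.norm_eq_abs] at this
        norm_num at this
        simp only [Polynomial.eval_mul]
        linarith
      all_goals
        apply Continuous.intervalIntegrable
        fun_prop
    have d3 : |(if i = j then h * polyIntegral (p * legendreP i) else 0) - (if i = j then h *
        ∫ x in (-1 : ℝ)..1, √(1 - x ^ 2) * (legendreP i).eval x else 0)| ≤
        ε * (|h| * (B' * 2)) := by
      split_ifs
      · rw [← mul_sub, abs_mul]
        calc _ ≤ |h| * (ε * (B' * 2)) := by gcongr
          _ = _ := by ring
      · rw [sub_zero, abs_zero]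
        positivity
    rw [e] at d1
    refine (abs_sub_le _ (4 / Real.pi * if i = j then h * polyIntegral (p * legendreP i) else 0)
      _).trans ?_
    rw [mul_add]
    refine add_le_add d1 ?_
    have hπ : 0 < 4 / Real.pi := by positivity
    rw [← mul_sub, abs_mul, abs_of_pos hπ]
    calc _ ≤ 4 / Real.pi * (ε * (|h| * (B' * 2))) := by gcongr
      _ = _ := by ring
  rw [← sub_eq_zero, ← abs_nonpos_iff]
  set K := 4 / Real.pi * B * 4 + 4 / Real.pi * (|h| * (B' * 2)) with hK
  have hK0 : 0 ≤ K := by positivity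
  refine le_of_forall_pos_le_add fun δ hδ => ?_
  -- Dividing by `K + 1` avoids a case distinction at `K = 0`.
  refine (key (δ / (K + 1)) (by positivity)).trans ?_
  rw [zero_add, div_mul_eq_mul_div, div_le_iff₀ (by positivity)]
  nlinarith

/-! ### Moments of `√(1 - x²)` and the explicit coefficients -/

theorem integral_pow_mul_sqrt_one_sub_sq_add_two (m : ℕ) :
    (m + 4 : ℝ) * ∫ x in (-1 : ℝ)..1, x ^ (m + 2) * √(1 - x ^ 2) =
      (m + 1 : ℝ) * ∫ x in (-1 : ℝ)..1, x ^ m * √(1 - x ^ 2) := by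
  -- The primitive `x^(m+1) (1 - x²)^(3/2)` vanishes at both ends; it is differentiated only in the
  -- open interval, where the root is smooth.
  have h := intervalIntegral.integral_eq_sub_of_hasDerivAt_of_le (a := -1) (b := 1) (by norm_num)
    (f := fun x : ℝ => x ^ (m + 1) * ((1 - x ^ 2) * √(1 - x ^ 2)))
    (f' := fun x => (m + 1) * (x ^ m * √(1 - x ^ 2)) - (m + 4) * (x ^ (m + 2) * √(1 - x ^ 2)))
    (by fun_prop) (fun x hx => by
      have h0 : 0 < 1 - x ^ 2 := by nlinarith [hx.1, hx.2]
      have hd : HasDerivAt (fun x : ℝ => 1 - x ^ 2) (-(2 * x)) x := by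
        simpa using (hasDerivAt_pow 2 x).const_sub 1
      have hs := hd.sqrt h0.ne'
      have hsq := Real.sq_sqrt h0.le
      have hpos := Real.sqrt_pos.2 h0
      have hq : (1 - x ^ 2) * (-(2 * x) / (2 * √(1 - x ^ 2))) = -x * √(1 - x ^ 2) := by
        nth_rw 1 [← hsq]
        field_simp
      have hm : HasDerivAt (fun x : ℝ => x ^ (m + 1) * ((1 - x ^ 2) * √(1 - x ^ 2)))
          (((m + 1 : ℕ) : ℝ) * x ^ m * ((1 - x ^ 2) * √(1 - x ^ 2)) + x ^ (m + 1) *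
            (-(2 * x) * √(1 - x ^ 2) + (1 - x ^ 2) * (-(2 * x) / (2 * √(1 - x ^ 2))))) x :=
        (hasDerivAt_pow (m + 1) x).mul (hd.mul hs)
      refine hm.congr_deriv ?_
      rw [hq]
      push_cast
      ring) (by
      apply Continuous.intervalIntegrable
      fun_prop)
  rw [intervalIntegral.integral_sub, intervalIntegral.integral_const_mul,
    intervalIntegral.integral_const_mul] at h
  · norm_num at h
    linarith
  all_goals
    apply Continuous.intervalIntegrable
    fun_prop

theorem ringChoose_succ_mul (r : ℝ) (k : ℕ) :
    Ring.choose r (k + 1) * (k + 1) = Ring.choose r k * (r - k) := by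
  have h := Ring.choose_smul_choose r (Nat.le_succ k)
  rw [Nat.succ_eq_add_one, Nat.choose_succ_self_right, Nat.add_sub_cancel_left,
    Ring.choose_one_right, nsmul_eq_mul] at h
  push_cast at h
  rw [mul_comm, h]

/-- Both sides start at `π / 2` and have the same successive ratio `(2k + 1) / (2k + 4) = -(1/2 - (k
+ 1)) / (k + 2)`. -/
theorem integral_pow_even_mul_sqrt_one_sub_sq (k : ℕ) :
    ∫ x in (-1 : ℝ)..1, x ^ (2 * k) * √(1 - x ^ 2) =
      Real.pi * (-1) ^ k * Ring.choose (1 / 2 : ℝ) (k + 1) := by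
  induction k with
  | zero => simp [integral_sqrt_one_sub_sq, div_eq_mul_inv]
  | succ k ih =>
    have h := integral_pow_mul_sqrt_one_sub_sq_add_two (2 * k)
    have h2 := ringChoose_succ_mul (1 / 2) (k + 1)
    rw [ih] at h
    rw [show 2 * (k + 1) = 2 * k + 2 by ring]
    push_cast at h h2
    have h3 : (2 * k + 4 : ℝ) ≠ 0 := by positivity
    apply mul_left_cancel₀ h3
    rw [h, pow_succ]
    linear_combination (2 * Real.pi * (-1) ^ k) * h2

theorem eval_legendreP_two_mul (n : ℕ) (x : ℝ) :
    (legendreP (2 * n)).eval x = (-1) ^ n / 2 ^ (2 * n) * ∑ k ∈ Finset.range (n + 1),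
      (-1) ^ k * ((2 * n).choose (n - k) : ℝ) * ((2 * n + 2 * k).choose (2 * k) : ℝ) *
        x ^ (2 * k) := by
  rw [Polynomial.eval_eq_sum_range' (n := 2 * (n + 1)) (by rw [natDegree_legendreP]; omega),
    sum_range_two_mul_of_odd_eq_zero _ (fun k => by
      rw [coeff_legendreP_eq_zero, zero_mul]
      exact ⟨k + n, by ring⟩), Finset.mul_sum]
  refine Finset.sum_congr rfl fun k hk => ?_
  have hk : k ≤ n := Finset.mem_range_succ_iff.1 hk
  rw [coeff_legendreP, show 2 * k + 2 * n = 2 * (n + k) by ring, coeff_X_sq_sub_one_pow_even,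
    Nat.descFactorial_eq_factorial_mul_choose]
  have e1 : (2 * n).choose (n + k) = (2 * n).choose (n - k) :=
    Nat.choose_symm_of_eq_add (by omega)
  have e2 : (2 * (n + k)).choose (2 * n) = (2 * n + 2 * k).choose (2 * k) := by
    rw [show 2 * (n + k) = 2 * n + 2 * k by ring]
    exact Nat.choose_symm_add
  have e3 : (-1 : ℝ) ^ (2 * n - (n + k)) = (-1) ^ n * (-1) ^ k := by
    obtain ⟨i, rfl⟩ := Nat.exists_eq_add_of_le hk
    rw [show 2 * (k + i) - (k + i + k) = i by omega, ← pow_add,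
      show k + i + k = 2 * k + i by ring, pow_add, pow_mul]
    simp
  rw [e1, e2, e3]
  have : ((2 * n).factorial : ℝ) ≠ 0 := by positivity
  push_cast
  field_simp

theorem integral_sqrt_mul_legendreP_two_mul (n : ℕ) :
    ∫ x in (-1 : ℝ)..1, √(1 - x ^ 2) * (legendreP (2 * n)).eval x =
      Real.pi * (-1) ^ n / 2 ^ (2 * n) * ∑ k ∈ Finset.range (n + 1),
        ((2 * n).choose (n - k) : ℝ) * ((2 * n + 2 * k).choose (2 * k) : ℝ) *
          Ring.choose (1 / 2 : ℝ) (k + 1) := by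
  have h : ∀ x : ℝ, √(1 - x ^ 2) * (legendreP (2 * n)).eval x =
      ∑ k ∈ Finset.range (n + 1), ((-1) ^ n / 2 ^ (2 * n) * ((-1) ^ k *
        ((2 * n).choose (n - k) : ℝ) * ((2 * n + 2 * k).choose (2 * k) : ℝ))) *
          (x ^ (2 * k) * √(1 - x ^ 2)) := by
    intro x
    rw [eval_legendreP_two_mul, mul_left_comm, Finset.mul_sum, Finset.mul_sum]
    refine Finset.sum_congr rfl fun k _ => ?_
    ring
  simp_rw [h]
  rw [intervalIntegral.integral_finsetSum (fun k _ => by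
    apply Continuous.intervalIntegrable; fun_prop), Finset.mul_sum]
  refine Finset.sum_congr rfl fun k _ => ?_
  rw [intervalIntegral.integral_const_mul, integral_pow_even_mul_sqrt_one_sub_sq]
  have : (-1 : ℝ) ^ k * (-1) ^ k = 1 := by rw [← mul_pow]; simp
  linear_combination ((-1) ^ n / 2 ^ (2 * n) * ((2 * n).choose (n - k) : ℝ) *
    ((2 * n + 2 * k).choose (2 * k) : ℝ) * Real.pi * Ring.choose (1 / 2 : ℝ) (k + 1)) * this

theorem integral_sqrt_mul_legendreP_of_odd {n : ℕ} (hn : Odd n) :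
    ∫ x in (-1 : ℝ)..1, √(1 - x ^ 2) * (legendreP n).eval x = 0 := by
  have h := intervalIntegral.integral_comp_neg (a := -1) (b := 1)
    (fun x : ℝ => √(1 - x ^ 2) * (legendreP n).eval x)
  simp only [neg_sq, eval_neg_legendreP, hn.neg_one_pow, neg_neg] at h
  simp only [neg_one_mul, mul_neg, intervalIntegral.integral_neg] at h
  linarith

theorem integral_legendreProd_sq (i j : ℕ) :
    ∫ z, legendreProd i j z ^ 2 ∂squareMeasure = 2 / (2 * i + 1) * (2 / (2 * j + 1)) := by
  simp_rw [sq]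
  rw [integral_legendreProd_mul, polyIntegral_legendreP_mul_self, polyIntegral_legendreP_mul_self]

theorem legendreCoeff_insolation_two_mul (n : ℕ) :
    legendreCoeff (fun p : ℝ × ℝ => insolation p.1 p.2) (2 * n) (2 * n) = insolationCoeff n := by
  rw [legendreCoeff, integral_insolation_mul_legendreProd, integral_legendreProd_sq, if_pos rfl,
    integral_sqrt_mul_legendreP_two_mul, polyIntegral_legendreP_mul_self, insolationCoeff]
  -- The exponent is an integer because it equals `-1` at `n = 0`.
  have hz : (2 : ℝ) ^ (2 * (n : ℤ) - 1) = 2 ^ (2 * n) / 2 := by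
    rw [zpow_sub_one₀ (by norm_num), div_eq_mul_inv]
    norm_cast
  rw [hz]
  have := Real.pi_pos
  push_cast
  field_simp
  ring

theorem legendreCoeff_insolation_of_ne_or_odd {i j : ℕ} (h : i ≠ j ∨ Odd i ∨ Odd j) :
    legendreCoeff (fun p : ℝ × ℝ => insolation p.1 p.2) i j = 0 := by
  rw [legendreCoeff, integral_insolation_mul_legendreProd]
  split_ifs with hij
  · subst hij
    have : Odd i := by tauto
    rw [integral_sqrt_mul_legendreP_of_odd this]
    simp
  · simp

/-! ### Best approximation and convergence in `L²` -/

theorem integral_insolation_mul_legendreProd_self (n : ℕ) :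
    ∫ z, insolation z.1 z.2 * legendreProd n n z ∂squareMeasure =
      legendreCoeff (fun p : ℝ × ℝ => insolation p.1 p.2) n n *
        (polyIntegral (legendreP n * legendreP n) * polyIntegral (legendreP n * legendreP n)) := by
  rw [legendreCoeff, integral_legendreProd_sq, polyIntegral_legendreP_mul_self, div_mul_cancel₀]
  positivity

theorem continuous_sum_legendreProd (N : ℕ) (b : ℕ → ℝ) :
    Continuous fun z => ∑ n ∈ Finset.range N, b n * legendreProd n n z := by
  have := fun n => continuous_legendreProd n n
  fun_prop

/-- The error of a partial sum of the Legendre series is orthogonal to the terms it contains. -/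
theorem integral_sub_partialSum_mul_legendreProd {N i : ℕ} (hi : i < N) :
    ∫ z, (insolation z.1 z.2 - ∑ n ∈ Finset.range N,
        legendreCoeff (fun p : ℝ × ℝ => insolation p.1 p.2) n n * legendreProd n n z) *
          legendreProd i i z ∂squareMeasure = 0 := by
  set c := fun n => legendreCoeff (fun p : ℝ × ℝ => insolation p.1 p.2) n n with hc
  have h1 : Integrable (fun z => insolation z.1 z.2 * legendreProd i i z) squareMeasure :=
    integrable_squareMeasure (continuous_insolation.mul (continuous_legendreProd i i))
  have h2 : Integrable (fun z => (∑ n ∈ Finset.range N, c n * legendreProd n n z) *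
      legendreProd i i z) squareMeasure :=
    integrable_squareMeasure ((continuous_sum_legendreProd N c).mul (continuous_legendreProd i i))
  simp_rw [sub_mul]
  rw [integral_sub h1 h2, integral_insolation_mul_legendreProd_self,
    integral_sum_legendreProd_mul, if_pos rfl, Finset.sum_mul, map_sum,
    Finset.sum_eq_single_of_mem i (Finset.mem_range.2 hi)]
  · rw [smul_mul_assoc, map_smul, smul_eq_mul]
    ring
  · intro n _ hn
    rw [smul_mul_assoc, map_smul, polyIntegral_legendreP_mul_of_ne hn, smul_zero]

/-- Partial sums of the Legendre series are best mean-square approximations. -/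
theorem integral_sq_sub_partialSum_le (N : ℕ) (b : ℕ → ℝ) :
    ∫ z, (insolation z.1 z.2 - ∑ n ∈ Finset.range N,
        legendreCoeff (fun p : ℝ × ℝ => insolation p.1 p.2) n n * legendreProd n n z) ^ 2
          ∂squareMeasure ≤
      ∫ z, (insolation z.1 z.2 - ∑ n ∈ Finset.range N, b n * legendreProd n n z) ^ 2
        ∂squareMeasure := by
  have horth := fun i (hi : i < N) => integral_sub_partialSum_mul_legendreProd hi
  set c := fun n => legendreCoeff (fun p : ℝ × ℝ => insolation p.1 p.2) n n with hc
  set e : ℝ × ℝ → ℝ := fun z => insolation z.1 z.2 -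
    ∑ n ∈ Finset.range N, c n * legendreProd n n z with he
  have hec : Continuous e := continuous_insolation.sub (continuous_sum_legendreProd N c)
  set d : ℝ × ℝ → ℝ := fun z => ∑ n ∈ Finset.range N, (c n - b n) * legendreProd n n z with hd
  have hdc : Continuous d := continuous_sum_legendreProd N _
  have h0 : ∫ z, e z * d z ∂squareMeasure = 0 := by
    have hi : ∀ n, Integrable (fun z => (c n - b n) * (e z * legendreProd n n z))
        squareMeasure := fun n => integrable_squareMeasure
      (continuous_const.mul (hec.mul (continuous_legendreProd n n)))
    simp_rw [hd, Finset.mul_sum, mul_left_comm (e _)]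
    rw [integral_finsetSum _ (fun n _ => hi n)]
    refine Finset.sum_eq_zero fun n hn => ?_
    rw [integral_const_mul, horth n (Finset.mem_range.1 hn), mul_zero]
  -- Pythagoras: the competitor's error is `e + d` with `e` orthogonal to `d`.
  have hsplit : ∀ z, (insolation z.1 z.2 - ∑ n ∈ Finset.range N, b n * legendreProd n n z) ^ 2 =
      e z ^ 2 + (d z ^ 2 + 2 * (e z * d z)) := by
    intro z
    simp only [he, hd, sub_mul, Finset.sum_sub_distrib]
    ring
  have hi1 : Integrable (fun z => e z ^ 2) squareMeasure := integrable_squareMeasure (hec.pow 2)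
  have hi2 : Integrable (fun z => d z ^ 2) squareMeasure := integrable_squareMeasure (hdc.pow 2)
  have hi3 : Integrable (fun z => 2 * (e z * d z)) squareMeasure :=
    integrable_squareMeasure (continuous_const.mul (hec.mul hdc))
  have hi23 : Integrable (fun z => d z ^ 2 + 2 * (e z * d z)) squareMeasure := hi2.add hi3
  simp_rw [hsplit]
  rw [integral_add hi1 hi23, integral_add hi2 hi3, integral_const_mul, h0]
  have : 0 ≤ ∫ z, d z ^ 2 ∂squareMeasure := integral_nonneg fun z => sq_nonneg _
  linarith

theorem tendsto_integral_sq_sub_partialSum :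
    Tendsto (fun N : ℕ => ∫ z, (insolation z.1 z.2 - ∑ n ∈ Finset.range N,
        legendreCoeff (fun p : ℝ × ℝ => insolation p.1 p.2) n n * legendreProd n n z) ^ 2
          ∂squareMeasure) atTop (𝓝 0) := by
  rw [Metric.tendsto_atTop]
  intro δ hδ
  have hπ := Real.pi_pos
  -- This tolerance makes the squared uniform error at most `δ / 8`, hence its integral over the
  -- square of area `4` at most `δ / 2`.
  obtain ⟨N, b, -, h⟩ := exists_sum_legendreP_near_insolation
    (show 0 < √(δ / 2) * Real.pi / 8 by positivity)
  refine ⟨N, fun M hM => ?_⟩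
  rw [Real.dist_0_eq_abs, abs_of_nonneg (integral_nonneg fun z => sq_nonneg _)]
  -- Extending `b` by zero lets the same approximant compete for every `M ≥ N`.
  refine (integral_sq_sub_partialSum_le M
    (fun n => if n < N then 4 / Real.pi * b n else 0)).trans_lt ?_
  have hsum : ∀ z, ∑ n ∈ Finset.range M, (if n < N then 4 / Real.pi * b n else 0) *
      legendreProd n n z = 4 / Real.pi * ∑ n ∈ Finset.range N, b n * legendreProd n n z := by
    intro z
    rw [Finset.mul_sum, ← Finset.sum_subset (Finset.range_mono hM)]
    · refine Finset.sum_congr rfl fun n hn => ?_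
      rw [if_pos (Finset.mem_range.1 hn), mul_assoc]
    · intro n _ hn
      rw [if_neg (by simpa using hn), zero_mul]
  simp_rw [hsum]
  have hb := norm_integral_le_of_norm_le_const (μ := squareMeasure)
    (f := fun z => (insolation z.1 z.2 -
      4 / Real.pi * ∑ n ∈ Finset.range N, b n * legendreProd n n z) ^ 2) (C := δ / 8) (by
      filter_upwards [ae_squareMeasure_mem] with z hz
      rw [norm_pow, Real.norm_eq_abs]
      calc _ ≤ (4 / Real.pi * (√(δ / 2) * Real.pi / 8)) ^ 2 := by
            gcongr
            exact h z hz
        _ = √(δ / 2) ^ 2 / 4 := by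
            field_simp
            ring
        _ = _ := by
            rw [Real.sq_sqrt (by positivity)]
            ring)
  rw [squareMeasure_real_univ] at hb
  refine (le_abs_self _).trans_lt (hb.trans_lt ?_)
  linarith

theorem memLp_squareMeasure {F : ℝ × ℝ → ℝ} (hF : Continuous F) : MemLp F 2 squareMeasure := by
  rw [memLp_two_iff_integrable_sq hF.aestronglyMeasurable]
  exact integrable_squareMeasure (hF.pow 2)

theorem eLpNorm_two_squareMeasure {F : ℝ × ℝ → ℝ} (hF : Continuous F) :
    eLpNorm F 2 squareMeasure = ENNReal.ofReal (√(∫ z, F z ^ 2 ∂squareMeasure)) := by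
  rw [(memLp_squareMeasure hF).eLpNorm_eq_integral_rpow_norm (by norm_num) (by norm_num),
    Real.sqrt_eq_rpow]
  simp

theorem theorem1 :
    MemLp (fun p : ℝ × ℝ => insolation p.1 p.2) 2 squareMeasure ∧
    Tendsto
      (fun N : ℕ => eLpNorm
        (fun p : ℝ × ℝ => insolation p.1 p.2 -
          ∑ n ∈ Finset.range N, insolationCoeff n *
            ((legendreP (2 * n)).eval p.2 * (legendreP (2 * n)).eval p.1))
        2 squareMeasure)
      atTop (𝓝 0) ∧
    (∀ n : ℕ, legendreCoeff (fun p : ℝ × ℝ => insolation p.1 p.2) (2 * n) (2 * n) =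
      insolationCoeff n) ∧
    (∀ i j : ℕ, i ≠ j ∨ Odd i ∨ Odd j →
      legendreCoeff (fun p : ℝ × ℝ => insolation p.1 p.2) i j = 0) := by
  refine ⟨memLp_squareMeasure continuous_insolation, ?_, legendreCoeff_insolation_two_mul,
    fun i j => legendreCoeff_insolation_of_ne_or_odd⟩
  -- The full diagonal series is taken along `2 * N`; its odd terms vanish, leaving the first `N`
  -- even ones.
  have h := tendsto_integral_sq_sub_partialSum.comp
    (tendsto_id.const_mul_atTop' (show 0 < 2 by norm_num))
  have h2 := ENNReal.tendsto_ofReal ((Real.continuous_sqrt.tendsto 0).comp h)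
  rw [Real.sqrt_zero, ENNReal.ofReal_zero] at h2
  refine h2.congr fun N => ?_
  have hs : ∀ z, ∑ n ∈ Finset.range (2 * N),
      legendreCoeff (fun p : ℝ × ℝ => insolation p.1 p.2) n n * legendreProd n n z =
      ∑ n ∈ Finset.range N, insolationCoeff n *
        ((legendreP (2 * n)).eval z.2 * (legendreP (2 * n)).eval z.1) := by
    intro z
    rw [sum_range_two_mul_of_odd_eq_zero _ (fun k => by
      rw [legendreCoeff_insolation_of_ne_or_odd (.inr (.inl ⟨k, rfl⟩)), zero_mul])]
    simp only [legendreCoeff_insolation_two_mul, legendreProd]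
  rw [eLpNorm_two_squareMeasure]
  · simp only [Function.comp_apply, id_eq, hs]
  · simp_rw [← hs]
    exact continuous_insolation.sub (continuous_sum_legendreProd _ _)
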